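/- Let $\mathcal X$ be a compact metric space, let $C:\mathcal X\times\mathcal X\to\mathbb R$ be $L$-Lipschitz, let $\alpha,\beta$ be Borel probability measures on $\mathcal X$, and let $n\ge 1$. For a probability measure $\mu$ on $\mathcal X$ and $h\in\mathcal C(\mathcal X)$ put $$T^{\beta}_{\mu}h(x)=-\log\int e^{h(y)-C(x,y)}\,d\mu(y),\qquad T^{\alpha}_{\mu}h(y)=-\log\int e^{h(x)-C(x,y)}\,d\mu(x).$$ Let $x_0,x_1,\dots\sim\alpha$ and $y_0,y_1,\dots\sim\beta$ be $\mathcal X$-valued random variables, all mutually independent, and let $\hat\alpha_t=\frac1n\sum_{i=tn}^{(t+1)n-1}\delta_{x_i}$, $\hat\beta_t=\frac1n\sum_{i=tn}^{(t+1)n-1}\delta_{y_i}$ be the minibatches. Starting from $(\hat f_0,\hat g_0)=(f_0,g_0)\in\mathcal C(\mathcal X)^2$, randomized Sinkhorn computes $$\hat f_{t+1}=T^{\beta}_{\hat\beta_t}\hat g_t,\qquad \hat g_{t+1}=T^{\alpha}_{\hat\alpha_t}\hat f_t\quad\text{(simultaneous updates)},$$ or, in the alternating form, $\hat f_{t+1}=T^{\beta}_{\hat\beta_t}\hat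 g_t$ and $\hat g_{t+1}=T^{\alpha}_{\hat\alpha_t}\hat f_{t+1}$. Let $\|f\|_{\mathrm{var}}=\max f-\min f$, and let $\mathcal C(\mathcal X)/\mathbb R$ be the space of continuous functions up to additive constants, normed by $\|\cdot\|_{\mathrm{var}}$. Then, for each of the two update rules: 1. For every $(f_0,g_0)$, $(\hat f_t,\hat g_t)_t$ is a time-homogeneous Markov chain on $\mathcal C(\mathcal X)^2$ (with the Borel $\sigma$-algebra of uniform convergence) for the filtration $\mathcal F_t=\sigma(\hat\alpha_s,\hat\beta_s:s<t)$; in particular $(\hat f_t,\hat g_t)$ is $\mathcal F_t$-measurable. Its transition kernel maps $(f,g)$ to the law of one step from $(f,g)$ with fresh independent minibatches. The classes $([\hat f_t],[\hat g_t])_t$ form a time-homogeneous Markov chain on $(\mathcal C(\mathcal X)/\mathbb R)^2$ for the same filtration, with the induced kernel. 2. The induced kernel has exactly one stationary probability measure $\pi$ on $(\mathcal C(\mathcal X)/\mathbb R)^2$, and for every initialization $(f_0,g_0)\in\mathcal C(\mathcal X)^2$ the law of $([\hat f_t],[\hat g_t])$ converges weakly to $\pi$ as $t\to\infty$. In particular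 the limit does not depend on $(f_0,g_0)$. -/

import Mathlib

open MeasureTheory ProbabilityTheory Filter Topology
open scoped NNReal ENNReal

noncomputable section

namespace RandomizedSinkhorn

/-! ### Potentials and the variation norm -/

section Potentials

variable {X : Type*} [TopologicalSpace X]

/-- `C(X)` carries the Borel σ-algebra of the topology of uniform convergence (`X` compact). -/
instance : MeasurableSpace C(X, ℝ) := borel _

instance : BorelSpace C(X, ℝ) := ⟨rfl⟩

/-- The variation norm `max f - min f`. It vanishes exactly on the constants. -/
def varNorm (f : C(X, ℝ)) : ℝ := (⨆ x, f x) - ⨅ x, f x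

variable (X) in
/-- The subgroup of constant functions. -/
def constants : AddSubgroup C(X, ℝ) where
  carrier := {f | ∃ a : ℝ, f = ContinuousMap.const X a}
  zero_mem' := ⟨0, rfl⟩
  add_mem' := by
    rintro _ _ ⟨a, rfl⟩ ⟨b, rfl⟩
    exact ⟨a + b, rfl⟩
  neg_mem' := by
    rintro _ ⟨a, rfl⟩
    exact ⟨-a, rfl⟩

variable (X) in
/-- Continuous functions up to an additive constant. -/
def PotentialClass : Type _ := C(X, ℝ) ⧸ constants X

instance : AddCommGroup (PotentialClass X) :=
  inferInstanceAs (AddCommGroup (C(X, ℝ) ⧸ constants X))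

/-- The class of a continuous function modulo constants. -/
def toClass (f : C(X, ℝ)) : PotentialClass X := (QuotientAddGroup.mk f : C(X, ℝ) ⧸ constants X)

/-- The classes of a pair of potentials. -/
def toClassPair (p : C(X, ℝ) × C(X, ℝ)) : PotentialClass X × PotentialClass X :=
  (toClass p.1, toClass p.2)

lemma toClass_eq_iff {f g : C(X, ℝ)} :
    toClass f = toClass g ↔ ∃ a : ℝ, g = f + ContinuousMap.const X a := by
  refine (QuotientAddGroup.eq (s := constants X) (a := f) (b := g)).trans ?_
  constructor
  · rintro ⟨a, ha⟩
    exact ⟨a, by rw [← ha]; abel⟩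
  · rintro ⟨a, rfl⟩
    exact ⟨a, by abel⟩

lemma toClass_surjective : Function.Surjective (toClass : C(X, ℝ) → PotentialClass X) :=
  QuotientAddGroup.mk_surjective

lemma toClass_add (f g : C(X, ℝ)) : toClass (f + g) = toClass f + toClass g := rfl

lemma toClass_sub (f g : C(X, ℝ)) : toClass (f - g) = toClass f - toClass g := rfl

lemma varNorm_le [Nonempty X] {f : C(X, ℝ)} {r : ℝ} (h : ∀ x y, f x - f y ≤ r) :
    varNorm f ≤ r := by
  have h1 : (⨆ x, f x) ≤ r + ⨅ x, f x := by
    refine ciSup_le fun x => ?_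
    have h2 : f x - r ≤ ⨅ y, f y := le_ciInf fun y => by linarith [h x y]
    linarith
  unfold varNorm
  linarith

lemma varNorm_of_isEmpty [IsEmpty X] (f : C(X, ℝ)) : varNorm f = 0 := by
  simp [varNorm, Real.iSup_of_isEmpty, Real.iInf_of_isEmpty]

variable [CompactSpace X]

lemma bddAbove_range (f : C(X, ℝ)) : BddAbove (Set.range f) :=
  (isCompact_range f.continuous).bddAbove

lemma bddBelow_range (f : C(X, ℝ)) : BddBelow (Set.range f) :=
  (isCompact_range f.continuous).bddBelow

lemma sub_le_varNorm (f : C(X, ℝ)) (x y : X) : f x - f y ≤ varNorm f :=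
  sub_le_sub (le_ciSup (bddAbove_range f) x) (ciInf_le (bddBelow_range f) y)

lemma varNorm_add_const (f : C(X, ℝ)) (a : ℝ) :
    varNorm (f + ContinuousMap.const X a) = varNorm f := by
  rcases isEmpty_or_nonempty X with hX | hX
  · simp [varNorm_of_isEmpty]
  · apply le_antisymm
    · refine varNorm_le fun x y => ?_
      simpa using sub_le_varNorm f x y
    · refine varNorm_le fun x y => ?_
      simpa using sub_le_varNorm (f + ContinuousMap.const X a) x y

/-- The variation norm on functions up to constants, as a norm on the quotient group. -/
def classNorm : AddGroupNorm (PotentialClass X) where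
  toFun := Quotient.lift varNorm (by
    intro f g hfg
    obtain ⟨a, rfl⟩ := toClass_eq_iff.1 (Quotient.sound hfg : toClass f = toClass g)
    exact (varNorm_add_const f a).symm)
  map_zero' := by
    change varNorm (0 : C(X, ℝ)) = 0
    rcases isEmpty_or_nonempty X with hX | hX
    · exact varNorm_of_isEmpty _
    · simp [varNorm]
  add_le' := by
    intro p q
    obtain ⟨f, rfl⟩ := toClass_surjective p
    obtain ⟨g, rfl⟩ := toClass_surjective q
    change varNorm (f + g) ≤ varNorm f + varNorm g
    rcases isEmpty_or_nonempty X with hX | hX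
    · simp [varNorm_of_isEmpty]
    · refine varNorm_le fun x y => ?_
      have h1 := sub_le_varNorm f x y
      have h2 := sub_le_varNorm g x y
      simp only [ContinuousMap.add_apply]
      linarith
  neg' := by
    intro p
    obtain ⟨f, rfl⟩ := toClass_surjective p
    change varNorm (-f) = varNorm f
    rcases isEmpty_or_nonempty X with hX | hX
    · simp [varNorm_of_isEmpty]
    · apply le_antisymm
      · refine varNorm_le fun x y => ?_
        have h1 := sub_le_varNorm f y x
        simp only [ContinuousMap.neg_apply]
        linarith
      · refine varNorm_le fun x y => ?_
        have h1 := sub_le_varNorm (-f) y x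
        simp only [ContinuousMap.neg_apply] at h1
        linarith
  eq_zero_of_map_eq_zero' := by
    intro p hp
    obtain ⟨f, rfl⟩ := toClass_surjective p
    change varNorm f = 0 at hp
    change toClass f = toClass 0
    rw [toClass_eq_iff]
    rcases isEmpty_or_nonempty X with hX | ⟨⟨x₀⟩⟩
    · exact ⟨0, Subsingleton.elim _ _⟩
    · refine ⟨-f x₀, ?_⟩
      ext x
      have h1 := sub_le_varNorm f x x₀
      have h2 := sub_le_varNorm f x₀ x
      simp only [ContinuousMap.zero_apply, ContinuousMap.add_apply, ContinuousMap.const_apply]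
      linarith

instance : NormedAddCommGroup (PotentialClass X) := AddGroupNorm.toNormedAddCommGroup classNorm

lemma norm_toClass (f : C(X, ℝ)) : ‖toClass f‖ = varNorm f := rfl

instance : MeasurableSpace (PotentialClass X) := borel _

instance : BorelSpace (PotentialClass X) := ⟨rfl⟩

lemma continuous_toClass : Continuous (toClass : C(X, ℝ) → PotentialClass X) := by
  have hL : LipschitzWith 2 (toClass : C(X, ℝ) → PotentialClass X) := by
    refine LipschitzWith.of_dist_le_mul fun f g => ?_
    rw [dist_eq_norm, dist_eq_norm, ← toClass_sub, norm_toClass]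
    rcases isEmpty_or_nonempty X with hX | hX
    · rw [varNorm_of_isEmpty]
      positivity
    · refine varNorm_le fun x y => ?_
      have h1 := (abs_le.1 ((f - g).norm_coe_le_norm x)).2
      have h2 := (abs_le.1 ((f - g).norm_coe_le_norm y)).1
      simp only [NNReal.coe_ofNat]
      linarith
  exact hL.continuous

lemma isOpenMap_toClass : IsOpenMap (toClass : C(X, ℝ) → PotentialClass X) := by
  intro U hU
  rw [Metric.isOpen_iff]
  rintro _ ⟨f, hf, rfl⟩
  obtain ⟨r, hr, hball⟩ := Metric.isOpen_iff.1 hU f hf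
  refine ⟨r, hr, fun q hq => ?_⟩
  obtain ⟨g, rfl⟩ := toClass_surjective q
  rw [Metric.mem_ball, dist_eq_norm, ← toClass_sub, norm_toClass] at hq
  rcases isEmpty_or_nonempty X with hX | ⟨⟨x₀⟩⟩
  · exact ⟨g, by rwa [Subsingleton.elim g f], rfl⟩
  · refine ⟨g + ContinuousMap.const X (-(g - f) x₀), hball ?_,
      (toClass_eq_iff.2 ⟨_, rfl⟩).symm⟩
    rw [Metric.mem_ball, ContinuousMap.dist_lt_iff hr]
    intro x
    have h1 := sub_le_varNorm (g - f) x x₀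
    have h2 := sub_le_varNorm (g - f) x₀ x
    rw [Real.dist_eq, abs_lt]
    simp only [ContinuousMap.sub_apply, ContinuousMap.add_apply, ContinuousMap.const_apply]
      at h1 h2 ⊢
    constructor <;> linarith

lemma isOpenQuotientMap_toClass :
    IsOpenQuotientMap (toClass : C(X, ℝ) → PotentialClass X) :=
  ⟨toClass_surjective, continuous_toClass, isOpenMap_toClass⟩

lemma isOpenQuotientMap_toClassPair :
    IsOpenQuotientMap (toClassPair : C(X, ℝ) × C(X, ℝ) → _) :=
  isOpenQuotientMap_toClass.prodMap isOpenQuotientMap_toClass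

instance {X : Type*} [MetricSpace X] [CompactSpace X] :
    SecondCountableTopology (PotentialClass X) :=
  isOpenQuotientMap_toClass.isQuotientMap.secondCountableTopology isOpenMap_toClass

end Potentials

/-! ### Soft C-transforms and one step of the algorithm -/

section Step

variable {X : Type*} [MetricSpace X] [CompactSpace X] [MeasurableSpace X] [BorelSpace X]

lemma integrable_of_continuous (μ : ProbabilityMeasure X) (φ : C(X, ℝ)) :
    Integrable φ (μ : Measure X) :=
  φ.continuous.integrable_of_hasCompactSupport (HasCompactSupport.of_compactSpace φ)

lemma integral_exp_sub_pos (c : C(X × X, ℝ)) (μ : ProbabilityMeasure X) (h : C(X, ℝ)) (x : X) :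
    0 < ∫ y, Real.exp (h y - c (x, y)) ∂(μ : Measure X) :=
  integral_exp_pos (integrable_of_continuous μ
    ⟨fun y => Real.exp (h y - c (x, y)), by fun_prop⟩)

/-- The soft C-transform `x ↦ - log ∫ exp (h y - c (x, y)) dμ(y)`. -/
def softCTransform (c : C(X × X, ℝ)) (μ : ProbabilityMeasure X) (h : C(X, ℝ)) : C(X, ℝ) where
  toFun x := -Real.log (∫ y, Real.exp (h y - c (x, y)) ∂(μ : Measure X))
  continuous_toFun := by
    have hc : Continuous fun x => ∫ y, Real.exp (h y - c (x, y)) ∂(μ : Measure X) := by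
      have := continuous_parametric_integral_of_continuous (μ := (μ : Measure X))
        (f := fun x y => Real.exp (h y - c (x, y))) (s := Set.univ) (by fun_prop) isCompact_univ
      simpa using this
    exact (hc.log fun x => (integral_exp_sub_pos c μ h x).ne').neg

/-- The cost with exchanged arguments, `(y, x) ↦ c (x, y)`. -/
def swapCost (c : C(X × X, ℝ)) : C(X × X, ℝ) := c.comp ⟨Prod.swap, continuous_swap⟩

/-- The two usual orders of the updates of a pair of potentials. -/
inductive UpdateRule
  /-- `f⁺ = T_b g` and `g⁺ = T_a f`. -/
  | simultaneous
  /-- `f⁺ = T_b g` and `g⁺ = T_a f⁺`. -/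
  | alternating

/-- One Sinkhorn step for the marginals `a` (in the first variable of the cost) and `b` (in the
second variable). -/
def step (rule : UpdateRule) (c : C(X × X, ℝ)) (a b : ProbabilityMeasure X)
    (p : C(X, ℝ) × C(X, ℝ)) : C(X, ℝ) × C(X, ℝ) :=
  match rule with
  | .simultaneous => (softCTransform c b p.2, softCTransform (swapCost c) a p.1)
  | .alternating =>
      (softCTransform c b p.2, softCTransform (swapCost c) a (softCTransform c b p.2))

lemma softCTransform_add_const (c : C(X × X, ℝ)) (μ : ProbabilityMeasure X) (h : C(X, ℝ))
    (r : ℝ) : softCTransform c μ (h + ContinuousMap.const X r) =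
      softCTransform c μ h + ContinuousMap.const X (-r) := by
  ext x
  have h1 : ∀ y, Real.exp ((h + ContinuousMap.const X r) y - c (x, y)) =
      Real.exp r * Real.exp (h y - c (x, y)) := by
    intro y
    rw [← Real.exp_add]
    congr 1
    simp only [ContinuousMap.add_apply, ContinuousMap.const_apply]
    ring
  change -Real.log (∫ y, Real.exp ((h + ContinuousMap.const X r) y - c (x, y)) ∂(μ : Measure X)) =
    -Real.log (∫ y, Real.exp (h y - c (x, y)) ∂(μ : Measure X)) + -r
  simp only [h1]
  rw [integral_const_mul, Real.log_mul (Real.exp_pos r).ne' (integral_exp_sub_pos c μ h x).ne',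
    Real.log_exp]
  ring

lemma toClass_softCTransform_congr (c : C(X × X, ℝ)) (μ : ProbabilityMeasure X)
    {h h' : C(X, ℝ)} (hh : toClass h = toClass h') :
    toClass (softCTransform c μ h) = toClass (softCTransform c μ h') := by
  obtain ⟨r, rfl⟩ := toClass_eq_iff.1 hh
  exact toClass_eq_iff.2 ⟨-r, softCTransform_add_const c μ h r⟩

lemma toClassPair_step_congr (rule : UpdateRule) (c : C(X × X, ℝ)) (a b : ProbabilityMeasure X)
    {p q : C(X, ℝ) × C(X, ℝ)} (h : toClassPair p = toClassPair q) :
    toClassPair (step rule c a b p) = toClassPair (step rule c a b q) := by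
  have h1 : toClass p.1 = toClass q.1 := congrArg Prod.fst h
  have h2 : toClass p.2 = toClass q.2 := congrArg Prod.snd h
  have h3 := toClass_softCTransform_congr c b h2
  cases rule
  · exact Prod.ext h3 (toClass_softCTransform_congr _ a h1)
  · exact Prod.ext h3 (toClass_softCTransform_congr _ a h3)

/-- The step induced on pairs of potentials up to constants. It does not depend on the chosen
representatives, see `classStep_toClassPair`. -/
def classStep (rule : UpdateRule) (c : C(X × X, ℝ)) (a b : ProbabilityMeasure X)
    (q : PotentialClass X × PotentialClass X) : PotentialClass X × PotentialClass X :=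
  toClassPair (step rule c a b (Function.surjInv isOpenQuotientMap_toClassPair.surjective q))

lemma classStep_toClassPair (rule : UpdateRule) (c : C(X × X, ℝ)) (a b : ProbabilityMeasure X)
    (p : C(X, ℝ) × C(X, ℝ)) :
    classStep rule c a b (toClassPair p) = toClassPair (step rule c a b p) :=
  toClassPair_step_congr rule c a b (Function.surjInv_eq _ _)

end Step

/-! ### Minibatches, the random iteration and its transition kernels -/

section Batches

variable {X : Type*} [MeasurableSpace X] {n : ℕ} [NeZero n]

/-- The empirical measure `1/n ∑ δ_{z i}` of a minibatch. -/
def empirical (z : Fin n → X) : ProbabilityMeasure X :=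
  ⟨(n : ℝ≥0∞)⁻¹ • ∑ i, Measure.dirac (z i), ⟨by
    simp only [Measure.smul_apply, Measure.finsetSum_apply, measure_univ, Finset.sum_const,
      Finset.card_univ, Fintype.card_fin, nsmul_eq_mul, mul_one, smul_eq_mul]
    exact ENNReal.inv_mul_cancel (by simpa using NeZero.ne n) (ENNReal.natCast_ne_top n)⟩⟩

variable (n) in
/-- The empirical measure of the `t`-th block of `n` consecutive samples of a stream. -/
def minibatch {Ω : Type*} (x : ℕ → Ω → X) (t : ℕ) (ω : Ω) : ProbabilityMeasure X :=
  empirical fun i : Fin n => x (t * n + i) ω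

variable (n) in
/-- The σ-algebra generated by the minibatch measures that the first `t` steps use (the numbers
`s < t`, as the step from time `s` to time `s + 1` uses the minibatches number `s`). -/
abbrev minibatchSigma {Ω : Type*} (x y : ℕ → Ω → X) (t : ℕ) : MeasurableSpace Ω :=
  ⨆ s < t, (MeasurableSpace.comap (fun ω => (minibatch n x s ω : Measure X)) inferInstance ⊔
    MeasurableSpace.comap (fun ω => (minibatch n y s ω : Measure X)) inferInstance)

variable (n) in
/-- The law of a pair of independent minibatches of `n` independent samples. -/
def batchLaw (α β : ProbabilityMeasure X) : Measure ((Fin n → X) × (Fin n → X)) :=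
  (Measure.pi fun _ => (α : Measure X)).prod (Measure.pi fun _ => (β : Measure X))

instance (α β : ProbabilityMeasure X) : IsProbabilityMeasure (batchLaw n α β) := by
  unfold batchLaw
  infer_instance

end Batches

/-- The laws of the images of a fixed random seed under a measurable family of maps form a
measurable family. -/
lemma measurable_map_seed {S E E' : Type*} [MeasurableSpace S] [MeasurableSpace E]
    [MeasurableSpace E'] (ν : Measure S) [SFinite ν] {G : E → S → E'}
    (hG : Measurable fun s : S × E => G s.2 s.1) : Measurable fun p : E => ν.map (G p) := by
  refine Measure.measurable_of_measurable_coe _ fun A hA => ?_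
  have h1 : ∀ p : E, ν.map (G p) A = ν ((fun s => (s, p)) ⁻¹' ((fun s : S × E => G s.2 s.1) ⁻¹' A)) :=
    fun p => Measure.map_apply (hG.comp measurable_prodMk_right) hA
  simp only [h1]
  exact measurable_measure_prodMk_right (hG hA)

section Chain

variable {X : Type*} [MetricSpace X] [CompactSpace X] [MeasurableSpace X] [BorelSpace X]
  {n : ℕ} [NeZero n]

variable (n) in
/-- The randomized Sinkhorn iteration along two sample streams `x` and `y`, started at `p₀`. -/
def chain {Ω : Type*} (rule : UpdateRule) (c : C(X × X, ℝ)) (x y : ℕ → Ω → X)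
    (p₀ : C(X, ℝ) × C(X, ℝ)) : ℕ → Ω → C(X, ℝ) × C(X, ℝ)
  | 0, _ => p₀
  | t + 1, ω =>
      step rule c (minibatch n x t ω) (minibatch n y t ω) (chain rule c x y p₀ t ω)

lemma softCTransform_empirical_apply (c : C(X × X, ℝ)) (z : Fin n → X) (h : C(X, ℝ)) (x : X) :
    softCTransform c (empirical z) h x =
      -Real.log ((n : ℝ)⁻¹ * ∑ i, Real.exp (h (z i) - c (x, z i))) := by
  change -Real.log (∫ y, Real.exp (h y - c (x, y))
    ∂((n : ℝ≥0∞)⁻¹ • ∑ i, Measure.dirac (z i) : Measure X)) = _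
  rw [integral_smul_measure, integral_finsetSum_measure]
  · simp
  · intro i _
    exact integrable_dirac (by simp)

lemma continuous_softCTransform_empirical (c : C(X × X, ℝ)) :
    Continuous fun s : (Fin n → X) × C(X, ℝ) => softCTransform c (empirical s.1) s.2 := by
  apply ContinuousMap.continuous_of_continuous_uncurry
  simp only [Function.uncurry_def, softCTransform_empirical_apply]
  refine (Continuous.log ?_ fun s => ?_).neg
  · fun_prop
  · have hn : (0 : ℝ) < n := by exact_mod_cast Nat.pos_of_ne_zero (NeZero.ne n)
    have : Nonempty (Fin n) := ⟨⟨0, Nat.pos_of_ne_zero (NeZero.ne n)⟩⟩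
    have : 0 < ∑ i, Real.exp (s.1.2 (s.1.1 i) - c (s.2, s.1.1 i)) :=
      Finset.sum_pos (fun _ _ => Real.exp_pos _) Finset.univ_nonempty
    positivity

lemma continuous_step_empirical (rule : UpdateRule) (c : C(X × X, ℝ)) :
    Continuous fun s : ((Fin n → X) × (Fin n → X)) × (C(X, ℝ) × C(X, ℝ)) =>
      step rule c (empirical s.1.1) (empirical s.1.2) s.2 := by
  have h1 : Continuous fun s : ((Fin n → X) × (Fin n → X)) × (C(X, ℝ) × C(X, ℝ)) =>
      softCTransform c (empirical s.1.2) s.2.2 :=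
    (continuous_softCTransform_empirical c).comp
      (g := fun s : (Fin n → X) × C(X, ℝ) => softCTransform c (empirical s.1) s.2)
      (f := fun s : ((Fin n → X) × (Fin n → X)) × (C(X, ℝ) × C(X, ℝ)) => (s.1.2, s.2.2))
      (by fun_prop)
  cases rule
  · exact h1.prodMk ((continuous_softCTransform_empirical (swapCost c)).comp
      (g := fun s : (Fin n → X) × C(X, ℝ) => softCTransform (swapCost c) (empirical s.1) s.2)
      (f := fun s : ((Fin n → X) × (Fin n → X)) × (C(X, ℝ) × C(X, ℝ)) => (s.1.1, s.2.1))
      (by fun_prop))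
  · exact h1.prodMk ((continuous_softCTransform_empirical (swapCost c)).comp
      (g := fun s : (Fin n → X) × C(X, ℝ) => softCTransform (swapCost c) (empirical s.1) s.2)
      (f := fun s : ((Fin n → X) × (Fin n → X)) × (C(X, ℝ) × C(X, ℝ)) =>
        (s.1.1, softCTransform c (empirical s.1.2) s.2.2))
      (by fun_prop))

lemma continuous_classStep_empirical (rule : UpdateRule) (c : C(X × X, ℝ)) :
    Continuous fun s : ((Fin n → X) × (Fin n → X)) × (PotentialClass X × PotentialClass X) =>
      classStep rule c (empirical s.1.1) (empirical s.1.2) s.2 := by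
  have hq : IsOpenQuotientMap (Prod.map id toClassPair :
      ((Fin n → X) × (Fin n → X)) × (C(X, ℝ) × C(X, ℝ)) → _) :=
    IsOpenQuotientMap.id.prodMap isOpenQuotientMap_toClassPair
  rw [← hq.continuous_comp_iff]
  simp only [Function.comp_def, Prod.map_fst, Prod.map_snd, id, classStep_toClassPair]
  exact isOpenQuotientMap_toClassPair.continuous.comp (continuous_step_empirical rule c)

lemma measurable_step_empirical (rule : UpdateRule) (c : C(X × X, ℝ)) :
    Measurable fun s : ((Fin n → X) × (Fin n → X)) × (C(X, ℝ) × C(X, ℝ)) =>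
      step rule c (empirical s.1.1) (empirical s.1.2) s.2 :=
  (continuous_step_empirical rule c).measurable

lemma measurable_classStep_empirical (rule : UpdateRule) (c : C(X × X, ℝ)) :
    Measurable fun s : ((Fin n → X) × (Fin n → X)) × (PotentialClass X × PotentialClass X) =>
      classStep rule c (empirical s.1.1) (empirical s.1.2) s.2 :=
  (continuous_classStep_empirical rule c).measurable

variable (n) in
/-- The transition kernel on `C(X)²`: from `p`, the law of one step with fresh minibatches. -/
def transitionKernel (rule : UpdateRule) (c : C(X × X, ℝ)) (α β : ProbabilityMeasure X) :
    Kernel (C(X, ℝ) × C(X, ℝ)) (C(X, ℝ) × C(X, ℝ)) where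
  toFun p := (batchLaw n α β).map fun s => step rule c (empirical s.1) (empirical s.2) p
  measurable' := by
    have h := measurable_step_empirical (n := n) rule c
    exact measurable_map_seed (batchLaw n α β) h

variable (n) in
/-- The transition kernel induced on pairs of potentials up to constants. -/
def classTransitionKernel (rule : UpdateRule) (c : C(X × X, ℝ)) (α β : ProbabilityMeasure X) :
    Kernel (PotentialClass X × PotentialClass X) (PotentialClass X × PotentialClass X) where
  toFun q := (batchLaw n α β).map fun s => classStep rule c (empirical s.1) (empirical s.2) q
  measurable' := by
    have h := measurable_classStep_empirical (n := n) rule c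
    exact measurable_map_seed (batchLaw n α β) h

instance (rule : UpdateRule) (c : C(X × X, ℝ)) (α β : ProbabilityMeasure X) :
    IsMarkovKernel (transitionKernel n rule c α β) :=
  ⟨fun _ => Measure.isProbabilityMeasure_map
    ((measurable_step_empirical rule c).comp measurable_prodMk_right).aemeasurable⟩

instance (rule : UpdateRule) (c : C(X × X, ℝ)) (α β : ProbabilityMeasure X) :
    IsMarkovKernel (classTransitionKernel n rule c α β) :=
  ⟨fun _ => Measure.isProbabilityMeasure_map
    ((measurable_classStep_empirical rule c).comp measurable_prodMk_right).aemeasurable⟩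

end Chain

/-- `Z` is a time-homogeneous Markov chain with transition kernel `κ` for the filtration `ℱ`. -/
structure IsTimeHomogeneousMarkovChain {Ω E : Type*} [MeasurableSpace E] [mΩ : MeasurableSpace Ω]
    (κ : Kernel E E) (ℱ : ℕ → MeasurableSpace Ω) (P : Measure Ω) (Z : ℕ → Ω → E) : Prop where
  isMarkovKernel : IsMarkovKernel κ
  mono : Monotone ℱ
  le : ∀ t, ℱ t ≤ mΩ
  adapted : ∀ t, Measurable[ℱ t] (Z t)
  markov : ∀ t (A : Set E), MeasurableSet A →
    P[(Z (t + 1) ⁻¹' A).indicator (fun _ => (1 : ℝ)) | ℱ t] =ᵐ[P] fun ω => (κ (Z t ω)).real A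

end RandomizedSinkhorn

end

/-! One step is a random map: a fixed function of the current state and of a fresh batch,
independent of the past. Every claim about the chain follows from this form and from one estimate.

The estimate (`dist_toClass_softCTransform_le`): if `|c| ≤ B`, every soft C-transform contracts the
variation norm by `1 - exp (-4B)`, whatever the measure. For `h' ≤ h ≤ h' + d`, the ratio `∫ exp (h
- c (x, ·)) / ∫ exp (h' - c (x, ·))` lies in `[1, exp d]`. Since `exp (-c)` changes by a factor at
most `exp (2B)` when `x` moves, the excess of the ratio over `1` changes by a factor at most `exp
(4B)`; concavity of `log` turns this into the contraction.

The steps on classes are therefore contractions with a common constant `K < 1` of a complete space.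
Composed backwards, `F (s 0) ∘ ⋯ ∘ F (s (t - 1))`, they converge for every seed sequence to a limit
`Λ s` independent of the starting point. For i.i.d. seeds the backward composition has the law of
the forward chain at time `t`, so these laws converge weakly to the law `π` of `Λ`. Stationarity is
the identity `Λ s = F (s 0) (Λ (shift s))`, and uniqueness follows since a stationary law is its own
limit (`exists_unique_invariant_of_contracting`).

The Markov property is Fubini for a seed independent of the past (`condExp_randomMap`). As the
filtration is generated by the minibatch measures and not by the samples, adaptedness needs
measurability of the transform in the measure (`measurable_softCTransform`). -/

/-! ### Markov kernels given by random maps -/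

section RandomMaps

variable {S E : Type*} [MeasurableSpace S] [MeasurableSpace E]

lemma bind_eq_map_prod {κ : Kernel E E} {ν : Measure S} [SFinite ν] {F : S → E → E}
    (hF : Measurable (Function.uncurry F)) (hκ : ∀ p, κ p = ν.map (F · p))
    (m : Measure E) [SFinite m] :
    m.bind κ = (ν.prod m).map (Function.uncurry F) := by
  ext A hA
  rw [Measure.bind_apply hA κ.measurable.aemeasurable, Measure.map_apply hF hA,
    Measure.prod_apply_symm (hF hA)]
  refine lintegral_congr fun p => ?_
  have hFp : Measurable fun x => F x p := hF.comp measurable_prodMk_right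
  rw [hκ, Measure.map_apply hFp hA]
  rfl

lemma map_randomMap_eq_bind {κ : Kernel E E} {ν : Measure S} [SFinite ν] {F : S → E → E}
    (hF : Measurable (Function.uncurry F)) (hκ : ∀ p, κ p = ν.map (F · p))
    {Ω : Type*} [MeasurableSpace Ω] {P : Measure Ω} [IsProbabilityMeasure P]
    {s : Ω → S} {Z : Ω → E} (hs : Measurable s) (hZ : Measurable Z) (hν : P.map s = ν)
    (hind : IndepFun s Z P) :
    P.map (fun ω => F (s ω) (Z ω)) = (P.map Z).bind κ := by
  have := Measure.isProbabilityMeasure_map (μ := P) hZ.aemeasurable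
  rw [bind_eq_map_prod hF hκ, ← hν,
    ← (indepFun_iff_map_prod_eq_prod_map_map hs.aemeasurable hZ.aemeasurable).1 hind,
    Measure.map_map hF (hs.prodMk hZ)]
  rfl

/-- Fubini on the joint law of the seed and the past `W`: with `W` frozen, the seed still has law
`ν`. A general target for `W` allows the identity into a coarser σ-algebra, as needed for
conditioning. -/
lemma measure_randomMap_inter {κ : Kernel E E} {ν : Measure S} [SFinite ν] {F : S → E → E}
    (hF : Measurable (Function.uncurry F)) (hκ : ∀ p, κ p = ν.map (F · p))
    {Ω Ω' : Type*} [MeasurableSpace Ω] [MeasurableSpace Ω'] {P : Measure Ω}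
    [IsProbabilityMeasure P] {s : Ω → S} {W : Ω → Ω'} {Z : Ω' → E} (hs : Measurable s)
    (hW : Measurable W) (hZ : Measurable Z) (hν : P.map s = ν) (hind : IndepFun s W P)
    {A : Set E} (hA : MeasurableSet A) {B : Set Ω'} (hB : MeasurableSet B) :
    P ((fun ω => F (s ω) (Z (W ω))) ⁻¹' A ∩ W ⁻¹' B) = ∫⁻ ω in W ⁻¹' B, κ (Z (W ω)) A ∂P := by
  have := Measure.isProbabilityMeasure_map (μ := P) hW.aemeasurable
  have hT : MeasurableSet {q : S × Ω' | F q.1 (Z q.2) ∈ A ∧ q.2 ∈ B} :=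
    ((hF.comp (measurable_fst.prodMk (hZ.comp measurable_snd))) hA).inter (measurable_snd hB)
  have h1 : P ((fun ω => F (s ω) (Z (W ω))) ⁻¹' A ∩ W ⁻¹' B) =
      P.map (fun ω => (s ω, W ω)) {q : S × Ω' | F q.1 (Z q.2) ∈ A ∧ q.2 ∈ B} :=
    (Measure.map_apply (hs.prodMk hW) hT).symm
  rw [h1, (indepFun_iff_map_prod_eq_prod_map_map hs.aemeasurable hW.aemeasurable).1 hind, hν,
    Measure.prod_apply_symm hT, lintegral_map (measurable_measure_prodMk_right hT) hW,
    ← lintegral_indicator (hW hB)]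
  refine lintegral_congr fun ω => ?_
  by_cases hω : W ω ∈ B
  · have hFp : Measurable fun a => F a (Z (W ω)) := hF.comp measurable_prodMk_right
    rw [Set.indicator_of_mem (Set.mem_preimage.2 hω), hκ, Measure.map_apply hFp hA]
    simp [hω, Set.preimage]
  · simp [hω]

lemma condExp_randomMap {κ : Kernel E E} [IsMarkovKernel κ] {ν : Measure S} [SFinite ν]
    {F : S → E → E}
    (hF : Measurable (Function.uncurry F)) (hκ : ∀ p, κ p = ν.map (F · p))
    {Ω : Type*} {m mΩ : MeasurableSpace Ω} {P : Measure Ω} [IsProbabilityMeasure P] (hm : m ≤ mΩ)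
    {s : Ω → S} {Z : Ω → E} (hs : Measurable s) (hZ : Measurable[m] Z) (hν : P.map s = ν)
    (hind : Indep m (MeasurableSpace.comap s inferInstance) P) {A : Set E} (hA : MeasurableSet A) :
    P[((fun ω => F (s ω) (Z ω)) ⁻¹' A).indicator (fun _ => (1 : ℝ)) | m]
      =ᵐ[P] fun ω => (κ (Z ω)).real A := by
  have hZ' : Measurable Z := hZ.mono hm le_rfl
  have hFm : Measurable fun ω => F (s ω) (Z ω) := hF.comp (hs.prodMk hZ')
  have hκm : Measurable[m] fun ω => (κ (Z ω)).real A :=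
    ENNReal.measurable_toReal.comp ((κ.measurable_coe hA).comp hZ)
  have hκi : Integrable (fun ω => (κ (Z ω)).real A) P := by
    refine Integrable.of_bound (hκm.mono hm le_rfl).aestronglyMeasurable 1 (ae_of_all _ fun ω => ?_)
    rw [Real.norm_of_nonneg measureReal_nonneg]
    exact measureReal_le_one
  refine (ae_eq_condExp_of_forall_setIntegral_eq hm
    ((integrable_const (1 : ℝ)).indicator (hFm hA)) (fun _ _ _ => hκi.integrableOn) ?_
    hκm.aestronglyMeasurable).symm
  intro B hB _
  -- The past is encoded by the identity from `(Ω, mΩ)` to `(Ω, m)`, which generates exactly `m`.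
  have hid : @Measurable Ω Ω mΩ m id := measurable_id'' hm
  have hind' : @IndepFun Ω S Ω mΩ _ m s id P := by
    refine (@IndepFun_iff_Indep Ω S Ω mΩ _ m s id P).2 ?_
    rw [MeasurableSpace.comap_id]
    exact hind.symm
  have key : P ((fun ω => F (s ω) (Z ω)) ⁻¹' A ∩ B) = ∫⁻ ω in B, κ (Z ω) A ∂P :=
    @measure_randomMap_inter S E _ _ κ ν _ F hF hκ Ω Ω mΩ m P _ s id Z hs hid hZ hν hind'
      A hA B hB
  have hone : ∫ ω in B, ((fun ω => F (s ω) (Z ω)) ⁻¹' A).indicator (fun _ => (1 : ℝ)) ω ∂P =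
      (P.restrict B).real ((fun ω => F (s ω) (Z ω)) ⁻¹' A) := integral_indicator_one (hFm hA)
  rw [hone, measureReal_restrict_apply (hFm hA), measureReal_def, key]
  exact integral_toReal ((κ.measurable_coe hA).comp hZ').aemeasurable
    (ae_of_all _ fun ω => measure_lt_top _ _)

end RandomMaps

/-! ### Head and tail of an i.i.d. sequence -/

section ShiftInfinitePi

variable {S : Type*} [MeasurableSpace S]

lemma measurePreserving_head_shift_infinitePi (ν : Measure S) [IsProbabilityMeasure ν] :
    MeasurePreserving (fun s : ℕ → S => (s 0, fun i => s (i + 1)))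
      (Measure.infinitePi fun _ => ν) (ν.prod (Measure.infinitePi fun _ => ν)) := by
  refine ⟨by fun_prop, ?_⟩
  have h0 : iIndepFun (fun (i : ℕ) (s : ℕ → S) => s i) (Measure.infinitePi fun _ => ν) :=
    iIndepFun_infinitePi (X := fun _ (x : S) => x) fun _ => measurable_id
  have hind : IndepFun (fun s : ℕ → S => s 0) (fun (s : ℕ → S) (i : ℕ) => s (i + 1))
      (Measure.infinitePi fun _ => ν) := by
    rw [IndepFun_iff_Indep]
    have hd : Disjoint ({0} : Set ℕ) (Set.Ioi 0) := by simp
    refine indep_of_indep_of_le_left (indep_of_indep_of_le_right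
      (indep_iSup_of_disjoint (fun i => (measurable_pi_apply i).comap_le) h0 hd) ?_) ?_
    · rw [← measurable_iff_comap_le]
      refine @measurable_pi_lambda _ _ _ (_) _ _ fun i => ?_
      exact measurable_iff_comap_le.2 (le_iSup₂_of_le (i + 1) (Nat.succ_pos i) le_rfl)
    · exact le_iSup₂_of_le 0 rfl le_rfl
  rw [(indepFun_iff_map_prod_eq_prod_map_map
      (by fun_prop : Measurable fun s : ℕ → S => s 0).aemeasurable
      (by fun_prop : Measurable fun (s : ℕ → S) (i : ℕ) => s (i + 1)).aemeasurable).1 hind,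
    Measure.infinitePi_map_eval]
  congr 1
  rw [(iIndepFun_iff_map_fun_eq_infinitePi_map (by fun_prop)).1
    (h0.precomp (add_left_injective 1))]
  simp only [Measure.infinitePi_map_eval]

end ShiftInfinitePi

/-! ### Uniformly contracting random maps -/

section Contraction

variable {S E : Type*}

/-- The composition `F (s 0) ∘ F (s 1) ∘ ⋯ ∘ F (s (t - 1))`. -/
def backwardIterate (F : S → E → E) : ℕ → (ℕ → S) → E → E
  | 0, _, p => p
  | t + 1, s, p => F (s 0) (backwardIterate F t (fun i => s (i + 1)) p)

lemma measurable_backwardIterate [MeasurableSpace S] [MeasurableSpace E] {F : S → E → E}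
    (hF : Measurable (Function.uncurry F)) (t : ℕ) :
    Measurable fun q : (ℕ → S) × E => backwardIterate F t q.1 q.2 := by
  induction t with
  | zero => exact measurable_snd
  | succ t ih =>
    have h1 : Measurable fun q : (ℕ → S) × E => ((fun i => q.1 (i + 1) : ℕ → S), q.2) := by
      fun_prop
    have h2 : Measurable fun q : (ℕ → S) × E => q.1 0 := by fun_prop
    exact hF.comp (h2.prodMk (ih.comp h1))

/-- Reversing the order of i.i.d. seeds does not change the law at a fixed time. In the induction
the outermost map uses the head `s 0`, independent of the tail that drives the inner iterate, so it
contributes one more application of `κ`. -/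
lemma map_backwardIterate [MeasurableSpace S] [MeasurableSpace E] {κ : Kernel E E}
    {ν : Measure S} [IsProbabilityMeasure ν]
    {F : S → E → E} (hF : Measurable (Function.uncurry F)) (hκ : ∀ p, κ p = ν.map (F · p))
    (m : Measure E) [IsProbabilityMeasure m] (t : ℕ) :
    ((Measure.infinitePi fun _ : ℕ => ν).prod m).map (fun q => backwardIterate F t q.1 q.2) =
      (fun μ => μ.bind κ)^[t] m := by
  induction t with
  | zero => exact measurePreserving_snd.map_eq
  | succ t ih =>
    have hB := measurable_backwardIterate hF t
    have := Measure.isProbabilityMeasure_map (μ := (Measure.infinitePi fun _ : ℕ => ν).prod m)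
      hB.aemeasurable
    have h1 := (measurePreserving_head_shift_infinitePi ν).prod (MeasurePreserving.id m)
    have h2 := (measurePreserving_prodAssoc ν (Measure.infinitePi fun _ : ℕ => ν) m).comp h1
    have h3 := ((MeasurePreserving.id ν).prod (hB.measurePreserving
      ((Measure.infinitePi fun _ : ℕ => ν).prod m))).comp h2
    rw [Function.iterate_succ_apply', ← ih, bind_eq_map_prod hF hκ, ← h3.map_eq,
      Measure.map_map hF h3.measurable]
    rfl

variable [MetricSpace E] {F : S → E → E} {K : ℝ≥0}

lemma dist_backwardIterate_le (hK : ∀ s, LipschitzWith K (F s)) (t : ℕ) (s : ℕ → S) (p q : E) :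
    dist (backwardIterate F t s p) (backwardIterate F t s q) ≤ K ^ t * dist p q := by
  induction t generalizing s with
  | zero => simp [backwardIterate]
  | succ t ih =>
    refine ((hK _).dist_le_mul _ _).trans ?_
    rw [pow_succ', mul_assoc]
    exact mul_le_mul_of_nonneg_left (ih _) K.2

/-- Passing from `t` to `t + 1` only replaces the innermost point `p` by its image under one more
map, a move of at most `R`, which the `t` outer maps shrink. In forward order the new map would be
outermost and no such bound would hold. -/
lemma dist_backwardIterate_succ_le (hK : ∀ s, LipschitzWith K (F s)) {p : E} {R : ℝ}
    (hR : ∀ s, dist p (F s p) ≤ R) (t : ℕ) (s : ℕ → S) :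
    dist (backwardIterate F t s p) (backwardIterate F (t + 1) s p) ≤ R * K ^ t := by
  induction t generalizing s with
  | zero => simpa [backwardIterate] using hR (s 0)
  | succ t ih =>
    refine ((hK _).dist_le_mul _ _).trans ?_
    rw [pow_succ', mul_left_comm]
    exact mul_le_mul_of_nonneg_left (ih _) K.2

lemma exists_tendsto_backwardIterate [CompleteSpace E] (hK : ∀ s, LipschitzWith K (F s))
    (hK1 : K < 1) {p₀ : E} {R : ℝ} (hR : ∀ s, dist p₀ (F s p₀) ≤ R) :
    ∃ Λ : (ℕ → S) → E, ∀ s p, Tendsto (fun t => backwardIterate F t s p) atTop (𝓝 (Λ s)) := by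
  have h1 : ∀ s, ∃ l, Tendsto (fun t => backwardIterate F t s p₀) atTop (𝓝 l) := fun s =>
    cauchySeq_tendsto_of_complete (cauchySeq_of_le_geometric (K : ℝ) R (by exact_mod_cast hK1)
      fun t => dist_backwardIterate_succ_le hK hR t s)
  choose Λ hΛ using h1
  refine ⟨Λ, fun s p => ?_⟩
  refine (hΛ s).congr_dist (squeeze_zero (fun _ => dist_nonneg)
    (fun t => dist_backwardIterate_le hK t s p₀ p) ?_)
  simpa using (tendsto_pow_atTop_nhds_zero_of_lt_one K.2
    (by exact_mod_cast hK1 : (K : ℝ) < 1)).mul_const (dist p₀ p)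

/-- A kernel given by uniformly contracting random maps of a complete space has a unique
stationary probability measure, and its iterates converge weakly to it from every initial law. -/
theorem exists_unique_invariant_of_contracting [CompleteSpace E] [MeasurableSpace E] [BorelSpace E]
    [MeasurableSpace S] {ν : Measure S} [IsProbabilityMeasure ν] {κ : Kernel E E}
    (hF : Measurable (Function.uncurry F)) (hκ : ∀ p, κ p = ν.map (F · p))
    (hK : ∀ s, LipschitzWith K (F s)) (hK1 : K < 1) {p₀ : E} {R : ℝ}
    (hR : ∀ s, dist p₀ (F s p₀) ≤ R) :
    ∃ (π : Measure E) (_ : IsProbabilityMeasure π), Kernel.Invariant κ π ∧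
      (∀ π' : Measure E, IsProbabilityMeasure π' → Kernel.Invariant κ π' → π' = π) ∧
      ∀ m : Measure E, IsProbabilityMeasure m → ∀ φ : BoundedContinuousFunction E ℝ,
        Tendsto (fun t => ∫ p, φ p ∂((fun μ => μ.bind κ)^[t] m)) atTop (𝓝 (∫ p, φ p ∂π)) := by
  obtain ⟨Λ, hΛ⟩ := exists_tendsto_backwardIterate hK hK1 hR
  have hΛm : Measurable Λ := measurable_of_tendsto_metrizable
    (fun t => (measurable_backwardIterate hF t).comp measurable_prodMk_right)
    (tendsto_pi_nhds.2 fun s => hΛ s p₀)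
  -- The recursion of the backward iterates passes to the limit by continuity of `F (s 0)`.
  have hΛF : ∀ s : ℕ → S, Λ s = F (s 0) (Λ fun i => s (i + 1)) := fun s =>
    tendsto_nhds_unique ((tendsto_add_atTop_iff_nat 1).2 (hΛ s p₀))
      (((hK (s 0)).continuous.tendsto _).comp (hΛ _ p₀))
  have hπ : IsProbabilityMeasure ((Measure.infinitePi fun _ : ℕ => ν).map Λ) :=
    Measure.isProbabilityMeasure_map hΛm.aemeasurable
  have hconv : ∀ m : Measure E, IsProbabilityMeasure m → ∀ φ : BoundedContinuousFunction E ℝ,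
      Tendsto (fun t => ∫ p, φ p ∂((fun μ => μ.bind κ)^[t] m)) atTop
        (𝓝 (∫ p, φ p ∂((Measure.infinitePi fun _ : ℕ => ν).map Λ))) := by
    intro m hm φ
    -- The limit is viewed on the space that also carries the initial point, so that the iterates
    -- converge to it pointwise and dominated convergence applies.
    have hΛ1 : Measurable fun q : (ℕ → S) × E => Λ q.1 := hΛm.comp measurable_fst
    have h1 : (Measure.infinitePi fun _ : ℕ => ν).map Λ =
        ((Measure.infinitePi fun _ : ℕ => ν).prod m).map fun q => Λ q.1 := by
      conv_lhs => rw [← (measurePreserving_fst (μ := Measure.infinitePi fun _ : ℕ => ν)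
        (ν := m)).map_eq, Measure.map_map hΛm measurable_fst]
      rfl
    rw [h1, integral_map hΛ1.aemeasurable
      φ.continuous.measurable.aestronglyMeasurable]
    simp_rw [← map_backwardIterate hF hκ m,
      fun t => integral_map (μ := (Measure.infinitePi fun _ : ℕ => ν).prod m)
        (measurable_backwardIterate hF t).aemeasurable
        (φ.continuous.measurable.aestronglyMeasurable (μ := Measure.map _ _))]
    refine tendsto_integral_of_dominated_convergence (fun _ => ‖φ‖) (fun t =>
      (φ.continuous.measurable.comp (measurable_backwardIterate hF t)).aestronglyMeasurable)
      (integrable_const _) (fun t => ae_of_all _ fun q => φ.norm_coe_le_norm _)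
      (ae_of_all _ fun q => (φ.continuous.tendsto _).comp (hΛ q.1 q.2))
  refine ⟨_, hπ, ?_, fun π' hπ' hinv => ?_, hconv⟩
  · have h1 := measurePreserving_head_shift_infinitePi ν
    have h2 := ((MeasurePreserving.id ν).prod
      (hΛm.measurePreserving (Measure.infinitePi fun _ : ℕ => ν))).comp h1
    rw [Kernel.Invariant, bind_eq_map_prod hF hκ, ← h2.map_eq, Measure.map_map hF h2.measurable]
    exact congrArg (fun f => Measure.map f _) (funext fun s => (hΛF s).symm)
  · refine ext_of_forall_integral_eq_of_IsFiniteMeasure fun φ => ?_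
    refine tendsto_nhds_unique ?_ (hconv π' hπ' φ)
    have h1 : ∀ t, (fun μ : Measure E => μ.bind κ)^[t] π' = π' := fun t =>
      Function.iterate_fixed (show π'.bind κ = π' from hinv) t
    simp only [h1]
    exact tendsto_const_nhds

end Contraction

namespace RandomizedSinkhorn

/-! ### Completeness of the space of potentials up to constants -/

section ClassSpace

variable {X : Type*} [TopologicalSpace X] [CompactSpace X]

/-- Representatives vanishing at a base point `x₀` are at uniform distance at most the variation
distance of their classes, so a Cauchy sequence of classes lifts to one in `C(X, ℝ)`. -/
instance : CompleteSpace (PotentialClass X) := by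
  refine Metric.complete_of_cauchySeq_tendsto fun u hu => ?_
  rcases isEmpty_or_nonempty X with hX | ⟨⟨x₀⟩⟩
  · refine ⟨toClass 0, ?_⟩
    have h1 : ∀ t, u t = toClass 0 := fun t => by
      obtain ⟨f, hf⟩ := toClass_surjective (u t)
      rw [← hf, Subsingleton.elim f 0]
    simp only [funext h1, tendsto_const_nhds_iff]
  · have h1 : ∀ q : PotentialClass X, ∃ f : C(X, ℝ), toClass f = q ∧ f x₀ = 0 := fun q => by
      obtain ⟨f, rfl⟩ := toClass_surjective q
      exact ⟨f + ContinuousMap.const X (-f x₀), (toClass_eq_iff.2 ⟨_, rfl⟩).symm, by simp⟩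
    choose r hr hr0 using h1
    have h2 : ∀ p q, dist (r p) (r q) ≤ dist p q := fun p q => by
      rw [ContinuousMap.dist_le dist_nonneg]
      intro x
      have h3 : dist p q = varNorm (r p - r q) := by
        rw [← norm_toClass, toClass_sub, hr, hr, dist_eq_norm]
      have h4 := sub_le_varNorm (r p - r q) x x₀
      have h5 := sub_le_varNorm (r p - r q) x₀ x
      simp only [ContinuousMap.sub_apply, hr0] at h4 h5
      rw [h3, Real.dist_eq, abs_le]
      constructor <;> linarith
    have h3 : CauchySeq fun t => r (u t) := by
      rw [Metric.cauchySeq_iff] at hu ⊢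
      intro ε hε
      obtain ⟨N, hN⟩ := hu ε hε
      exact ⟨N, fun a ha b hb => (h2 _ _).trans_lt (hN a ha b hb)⟩
    obtain ⟨f, hf⟩ := cauchySeq_tendsto_of_complete h3
    refine ⟨toClass f, ?_⟩
    have h4 := (continuous_toClass.tendsto f).comp hf
    simpa only [Function.comp_def, hr] using h4

lemma dist_toClass (f g : C(X, ℝ)) : dist (toClass f) (toClass g) = varNorm (f - g) := by
  rw [dist_eq_norm, ← toClass_sub, norm_toClass]

end ClassSpace

/-! ### Contraction of the variation norm by the soft C-transform -/

section SoftTransform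

variable {X : Type*} [MetricSpace X] [CompactSpace X] [MeasurableSpace X] [BorelSpace X]

lemma softCTransform_apply (c : C(X × X, ℝ)) (μ : ProbabilityMeasure X) (h : C(X, ℝ)) (x : X) :
    softCTransform c μ h x = -Real.log (∫ y, Real.exp (h y - c (x, y)) ∂(μ : Measure X)) := rfl

lemma integrable_exp_sub (c : C(X × X, ℝ)) (μ : ProbabilityMeasure X) (h : C(X, ℝ)) (x : X) :
    Integrable (fun y => Real.exp (h y - c (x, y))) (μ : Measure X) :=
  integrable_of_continuous μ ⟨fun y => Real.exp (h y - c (x, y)), by fun_prop⟩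

omit [CompactSpace X] [MeasurableSpace X] [BorelSpace X] in
lemma exp_sub_le_of_abs_le {c : C(X × X, ℝ)} {B : ℝ} (hB : ∀ p, |c p| ≤ B) (r : ℝ) (x x' y : X) :
    Real.exp (r - c (x, y)) ≤ Real.exp (2 * B) * Real.exp (r - c (x', y)) := by
  rw [← Real.exp_add, Real.exp_le_exp]
  have h1 := abs_le.1 (hB (x, y))
  have h2 := abs_le.1 (hB (x', y))
  linarith

/-- Concavity of `log` between `1` and `A` gives `ε log A ≤ log (1 + ε (A - 1))`. -/
lemma log_sub_log_le_of_mix {A r ε : ℝ} (hA : 1 ≤ A) (hε : 0 ≤ ε) (hε1 : ε ≤ 1)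
    (hr : 1 + ε * (A - 1) ≤ r) : Real.log A - Real.log r ≤ (1 - ε) * Real.log A := by
  have h0 : 0 ≤ ε * (A - 1) := mul_nonneg hε (by linarith)
  have h1 : ε * Real.log A ≤ Real.log (1 + ε * (A - 1)) := by
    have h2 := strictConcaveOn_log_Ioi.concaveOn.2 (Set.mem_Ioi.2 (by linarith : 0 < A))
      (Set.mem_Ioi.2 one_pos) hε (by linarith : 0 ≤ 1 - ε) (by ring)
    simp only [smul_eq_mul, Real.log_one, mul_zero, add_zero, mul_one] at h2
    rwa [show 1 + ε * (A - 1) = ε * A + (1 - ε) by ring]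
  have h3 := Real.log_le_log (by linarith) hr
  linarith

lemma softCTransform_sub_sub_le {c : C(X × X, ℝ)} {B d : ℝ} (hB : ∀ p, |c p| ≤ B)
    (μ : ProbabilityMeasure X) {h h' : C(X, ℝ)} (h0 : ∀ y, h' y ≤ h y) (hd : ∀ y, h y ≤ h' y + d)
    (x x' : X) :
    (softCTransform c μ h x - softCTransform c μ h' x) -
      (softCTransform c μ h x' - softCTransform c μ h' x') ≤ (1 - Real.exp (-(4 * B))) * d := by
  simp only [softCTransform_apply]
  set I := fun x => ∫ y, Real.exp (h y - c (x, y)) ∂(μ : Measure X) with hI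
  set J := fun x => ∫ y, Real.exp (h' y - c (x, y)) ∂(μ : Measure X) with hJ
  have hIp : ∀ x, 0 < I x := integral_exp_sub_pos c μ h
  have hJp : ∀ x, 0 < J x := integral_exp_sub_pos c μ h'
  have hBnn : 0 ≤ B := (abs_nonneg _).trans (hB (x, x))
  have hε1 : Real.exp (-(4 * B)) ≤ 1 := Real.exp_le_one_iff.2 (by linarith)
  have hJI : J x' ≤ I x' := integral_mono (integrable_exp_sub c μ h' x')
    (integrable_exp_sub c μ h x') fun y => Real.exp_le_exp.2 (by linarith [h0 y])
  have hId : I x' ≤ Real.exp d * J x' := by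
    simp only [hI, hJ]
    rw [← integral_const_mul]
    refine integral_mono (integrable_exp_sub c μ h x')
      ((integrable_exp_sub c μ h' x').const_mul _) fun y => ?_
    simp only [← Real.exp_add]
    exact Real.exp_le_exp.2 (by linarith [hd y])
  have hJJ : J x ≤ Real.exp (2 * B) * J x' := by
    simp only [hJ]
    rw [← integral_const_mul]
    exact integral_mono (integrable_exp_sub c μ h' x)
      ((integrable_exp_sub c μ h' x').const_mul _) fun y => exp_sub_le_of_abs_le hB _ _ _ _
  -- As `h' ≤ h`, the weight `exp h - exp h'` is nonnegative, so the pointwise comparison of `exp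
  -- (-c)` applies to the difference too.
  have hDD : I x' - J x' ≤ Real.exp (2 * B) * (I x - J x) := by
    simp only [hI, hJ]
    rw [← integral_sub (integrable_exp_sub c μ h x') (integrable_exp_sub c μ h' x'),
      ← integral_sub (integrable_exp_sub c μ h x) (integrable_exp_sub c μ h' x),
      ← integral_const_mul]
    refine integral_mono ((integrable_exp_sub c μ h x').sub (integrable_exp_sub c μ h' x'))
      (((integrable_exp_sub c μ h x).sub (integrable_exp_sub c μ h' x)).const_mul _) fun y => ?_
    have h1 : ∀ z, Real.exp (h y - c (z, y)) - Real.exp (h' y - c (z, y)) =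
        (Real.exp (h y) - Real.exp (h' y)) * Real.exp (0 - c (z, y)) := fun z => by
      rw [sub_mul, ← Real.exp_add, ← Real.exp_add]
      congr 2 <;> ring
    simp only [h1]
    rw [mul_left_comm]
    exact mul_le_mul_of_nonneg_left (exp_sub_le_of_abs_le hB _ _ _ _)
      (sub_nonneg.2 (Real.exp_le_exp.2 (h0 y)))
  -- One factor `exp (2B)` comes from the numerator `I - J`, the other from the denominator `J`.
  have hmix : 1 + Real.exp (-(4 * B)) * (I x' / J x' - 1) ≤ I x / J x := by
    have h1 : I x / J x = 1 + (I x - J x) / J x := by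
      field_simp [(hJp x).ne']
      ring
    have h2 : I x' / J x' - 1 = (I x' - J x') / J x' := by
      field_simp [(hJp x').ne']
    have h3 : Real.exp (-(4 * B)) * (Real.exp (2 * B) * Real.exp (2 * B)) = 1 := by
      rw [← Real.exp_add, ← Real.exp_add, ← Real.exp_zero]
      congr 1
      ring
    rw [h1, h2, add_le_add_iff_left, ← mul_div_assoc, div_le_div_iff₀ (hJp x') (hJp x)]
    calc Real.exp (-(4 * B)) * (I x' - J x') * J x
        ≤ Real.exp (-(4 * B)) * (Real.exp (2 * B) * (I x - J x)) * (Real.exp (2 * B) * J x') := by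
          have h4 : 0 ≤ I x - J x := by
            have := (sub_nonneg.2 hJI).trans hDD
            exact nonneg_of_mul_nonneg_right this (Real.exp_pos _)
          have := hJp x
          gcongr
      _ = (Real.exp (-(4 * B)) * (Real.exp (2 * B) * Real.exp (2 * B))) *
          ((I x - J x) * J x') := by ring
      _ = (I x - J x) * J x' := by rw [h3, one_mul]
  have hlog := log_sub_log_le_of_mix ((one_le_div (hJp x')).2 hJI) (Real.exp_pos _).le hε1 hmix
  have hlogd : Real.log (I x' / J x') ≤ d := by
    rw [Real.log_le_iff_le_exp (div_pos (hIp x') (hJp x')), div_le_iff₀ (hJp x')]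
    exact hId
  have hfin := mul_le_mul_of_nonneg_left hlogd (sub_nonneg.2 hε1)
  rw [Real.log_div (hIp x').ne' (hJp x').ne', Real.log_div (hIp x).ne' (hJp x).ne'] at hlog
  rw [Real.log_div (hIp x').ne' (hJp x').ne'] at hfin
  simp only [hI, hJ] at hlog hfin
  linarith

/-- The soft C-transform contracts the variation norm, uniformly in the measure. -/
lemma dist_toClass_softCTransform_le {c : C(X × X, ℝ)} {B : ℝ} (hB : ∀ p, |c p| ≤ B)
    (μ : ProbabilityMeasure X) (h h' : C(X, ℝ)) :
    dist (toClass (softCTransform c μ h)) (toClass (softCTransform c μ h')) ≤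
      (1 - Real.exp (-(4 * B))) * dist (toClass h) (toClass h') := by
  have hX : Nonempty X := (μ : Measure X).nonempty_of_neZero
  -- Raising `h'` by the minimum of `h - h'` keeps its class and gives `h' ≤ h ≤ h' + d` with `d`
  -- the variation norm of `h - h'`.
  have h1 : toClass h' = toClass (h' + ContinuousMap.const X (⨅ x, (h - h') x)) :=
    toClass_eq_iff.2 ⟨_, rfl⟩
  rw [toClass_softCTransform_congr c μ h1, dist_toClass, dist_toClass]
  refine varNorm_le fun x x' => ?_
  refine softCTransform_sub_sub_le hB μ (fun y => ?_) (fun y => ?_) x x'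
  · have h2 : (⨅ x, (h - h') x) ≤ h y - h' y := ciInf_le (bddBelow_range (h - h')) y
    rw [ContinuousMap.add_apply, ContinuousMap.const_apply]
    linarith
  · have h2 : h y - h' y ≤ ⨆ x, (h - h') x := le_ciSup (bddAbove_range (h - h')) y
    rw [ContinuousMap.add_apply, ContinuousMap.const_apply, varNorm]
    linarith

lemma lipschitzWith_classStep {c : C(X × X, ℝ)} {B : ℝ} (hB : ∀ p, |c p| ≤ B)
    (rule : UpdateRule) (a b : ProbabilityMeasure X) :
    LipschitzWith (1 - Real.exp (-(4 * B))).toNNReal (classStep rule c a b) := by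
  have hX : Nonempty X := (a : Measure X).nonempty_of_neZero
  obtain ⟨x₀⟩ := hX
  have hBnn : 0 ≤ B := (abs_nonneg _).trans (hB (x₀, x₀))
  have hε1 : Real.exp (-(4 * B)) ≤ 1 := Real.exp_le_one_iff.2 (by linarith)
  have hB' : ∀ p, |swapCost c p| ≤ B := fun p => hB p.swap
  refine LipschitzWith.of_dist_le_mul fun q q' => ?_
  obtain ⟨p, rfl⟩ := isOpenQuotientMap_toClassPair.surjective q
  obtain ⟨p', rfl⟩ := isOpenQuotientMap_toClassPair.surjective q'
  rw [classStep_toClassPair, classStep_toClassPair, Real.coe_toNNReal _ (by linarith)]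
  have hK0 : 0 ≤ 1 - Real.exp (-(4 * B)) := by linarith
  have hK1 : 1 - Real.exp (-(4 * B)) ≤ 1 := by linarith [Real.exp_pos (-(4 * B))]
  have h1 : dist (toClass p.1) (toClass p'.1) ≤ dist (toClassPair p) (toClassPair p') :=
    le_max_left _ _
  have h2 : dist (toClass p.2) (toClass p'.2) ≤ dist (toClassPair p) (toClassPair p') :=
    le_max_right _ _
  have h3 := (dist_toClass_softCTransform_le hB b p.2 p'.2).trans
    (mul_le_mul_of_nonneg_left h2 hK0)
  cases rule
  · exact max_le h3 ((dist_toClass_softCTransform_le hB' a p.1 p'.1).trans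
      (mul_le_mul_of_nonneg_left h1 hK0))
  -- The second potential is transformed twice in the alternating rule; one of its two contraction
  -- factors is bounded by `1`.
  · refine max_le h3 ((dist_toClass_softCTransform_le hB' a _ _).trans
      (mul_le_mul_of_nonneg_left (h3.trans ?_) hK0))
    exact mul_le_of_le_one_left dist_nonneg hK1

end SoftTransform

/-! ### Measurability of the step in the measures and the potentials -/

section Measurability

variable {X : Type*} [MetricSpace X] [CompactSpace X]

/-- By separability, the Borel σ-algebra of `C(X, ℝ)` is generated by evaluations: a closed ball is
cut out by countably many of them, and an open set is a countable union of closed balls. -/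
lemma measurable_of_measurable_eval {Ω : Type*} [MeasurableSpace Ω] {f : Ω → C(X, ℝ)}
    (hf : ∀ x, Measurable fun ω => f ω x) : Measurable f := by
  rcases isEmpty_or_nonempty X with hX | hX
  · have : Subsingleton C(X, ℝ) := ⟨fun a b => ContinuousMap.ext fun x => isEmptyElim x⟩
    exact measurable_of_subsingleton_codomain f
  have hball : ∀ (g : C(X, ℝ)) (r : ℝ), 0 ≤ r → MeasurableSet (f ⁻¹' Metric.closedBall g r) := by
    intro g r hr
    have h1 : f ⁻¹' Metric.closedBall g r =
        ⋂ k, {ω | dist (f ω (TopologicalSpace.denseSeq X k))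
          (g (TopologicalSpace.denseSeq X k)) ≤ r} := by
      ext ω
      simp only [Set.mem_preimage, Metric.mem_closedBall, Set.mem_iInter, Set.mem_ofPred_eq]
      refine ⟨fun h k => (ContinuousMap.dist_apply_le_dist _).trans h, fun h => ?_⟩
      rw [ContinuousMap.dist_le hr]
      intro x
      have hcl : IsClosed {x | dist (f ω x) (g x) ≤ r} :=
        isClosed_le (by fun_prop) continuous_const
      have := (TopologicalSpace.denseRange_denseSeq X).closure_range.symm.subset (Set.mem_univ x)
      exact hcl.closure_subset_iff.2 (Set.range_subset_iff.2 h) this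
    rw [h1]
    exact MeasurableSet.iInter fun k =>
      measurableSet_le ((hf _).dist measurable_const) measurable_const
  refine measurable_of_isOpen fun U hU => ?_
  obtain ⟨D, hDc, hDd⟩ := TopologicalSpace.exists_countable_dense C(X, ℝ)
  have h2 : U = ⋃ g ∈ D, ⋃ k : ℕ, ⋃ (_ : Metric.closedBall g (1 / (k + 1 : ℝ)) ⊆ U),
      Metric.closedBall g (1 / (k + 1 : ℝ)) := by
    refine Set.Subset.antisymm (fun u hu => ?_) (by simp)
    obtain ⟨ε, hε, hεU⟩ := Metric.isOpen_iff.1 hU u hu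
    -- With a radius below `ε / 2`, a closed ball containing `u` stays within `ε` of `u`.
    obtain ⟨k, hk⟩ := exists_nat_one_div_lt (half_pos hε)
    have hk0 : (0 : ℝ) < 1 / (k + 1) := Nat.one_div_pos_of_nat
    obtain ⟨g, hgD, hg⟩ := hDd.exists_dist_lt u hk0
    simp only [Set.mem_iUnion, exists_prop]
    refine ⟨g, hgD, k, fun v hv => hεU ?_, Metric.mem_closedBall.2 hg.le⟩
    rw [Metric.mem_ball]
    have h4 := dist_triangle v g u
    rw [dist_comm u g] at hg
    linarith [Metric.mem_closedBall.1 hv]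
  rw [h2]
  simp only [Set.preimage_iUnion]
  exact MeasurableSet.biUnion hDc fun g _ => MeasurableSet.iUnion fun k =>
    MeasurableSet.iUnion fun _ => hball g _ Nat.one_div_pos_of_nat.le

variable [MeasurableSpace X] [BorelSpace X]

/-- A measurable random measure is a kernel, so each value of the transform is a function of a
kernel integral. Continuity in the samples would only give measurability for the σ-algebra of the
samples. -/
lemma measurable_softCTransform (c : C(X × X, ℝ)) {Ω : Type*} [MeasurableSpace Ω]
    {μ : Ω → ProbabilityMeasure X} {h : Ω → C(X, ℝ)}
    (hμ : Measurable fun ω => (μ ω : Measure X)) (hh : Measurable h) :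
    Measurable fun ω => softCTransform c (μ ω) (h ω) := by
  refine measurable_of_measurable_eval fun x => ?_
  let κ : Kernel Ω X := ⟨fun ω => (μ ω : Measure X), hμ⟩
  have : IsMarkovKernel κ := ⟨fun ω => inferInstanceAs (IsProbabilityMeasure (μ ω : Measure X))⟩
  have h1 : Measurable fun q : Ω × X => Real.exp (h q.1 q.2 - c (x, q.2)) := by
    have h2 : Continuous fun q : C(X, ℝ) × X => Real.exp (q.1 q.2 - c (x, q.2)) := by fun_prop
    exact h2.measurable.comp ((hh.comp measurable_fst).prodMk measurable_snd)
  have h2 : StronglyMeasurable fun ω => ∫ y, Real.exp (h ω y - c (x, y)) ∂(κ ω) :=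
    StronglyMeasurable.integral_kernel_prod_right h1.stronglyMeasurable
  exact h2.measurable.log.neg

lemma measurable_step (rule : UpdateRule) (c : C(X × X, ℝ)) {Ω : Type*} [MeasurableSpace Ω]
    {a b : Ω → ProbabilityMeasure X} {p : Ω → C(X, ℝ) × C(X, ℝ)}
    (ha : Measurable fun ω => (a ω : Measure X)) (hb : Measurable fun ω => (b ω : Measure X))
    (hp : Measurable p) : Measurable fun ω => step rule c (a ω) (b ω) (p ω) := by
  have h1 := measurable_softCTransform c hb hp.snd
  cases rule
  · exact h1.prodMk (measurable_softCTransform (swapCost c) ha hp.fst)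
  · exact h1.prodMk (measurable_softCTransform (swapCost c) ha h1)

end Measurability

/-! ### Independence and laws of the sample blocks -/

section Samples

variable {X Ω : Type*} [MeasurableSpace X] [mΩ : MeasurableSpace Ω] {n : ℕ} [NeZero n]
  {x y : ℕ → Ω → X}

lemma measurable_empirical : Measurable fun z : Fin n → X => (empirical z : Measure X) := by
  refine Measure.measurable_of_measurable_coe _ fun A hA => ?_
  have h1 : ∀ z : Fin n → X, (empirical z : Measure X) A =
      (n : ℝ≥0∞)⁻¹ * ∑ i, A.indicator 1 (z i) := fun z => by
    change ((n : ℝ≥0∞)⁻¹ • ∑ i, Measure.dirac (z i) : Measure X) A = _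
    simp [Measure.dirac_apply' _ hA]
  simp only [h1]
  refine Measurable.const_mul (Finset.measurable_sum _ fun i _ => ?_) _
  exact (measurable_one.indicator hA).comp (measurable_pi_apply i)

variable (n) in
/-- The samples that the step from time `t` to time `t + 1` uses. -/
def sampleBlock (x y : ℕ → Ω → X) (t : ℕ) (ω : Ω) : (Fin n → X) × (Fin n → X) :=
  (fun i => x (t * n + i) ω, fun i => y (t * n + i) ω)

/-- The σ-algebra generated by the samples with the indices in `I`. -/
abbrev sampleSigma (x y : ℕ → Ω → X) (I : Set (ℕ ⊕ ℕ)) : MeasurableSpace Ω :=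
  ⨆ i ∈ I, MeasurableSpace.comap (Sum.elim x y i) inferInstance

omit mΩ in
lemma measurable_sampleSigma {I : Set (ℕ ⊕ ℕ)} {i : ℕ ⊕ ℕ} (hi : i ∈ I) :
    Measurable[sampleSigma x y I] (Sum.elim x y i) :=
  measurable_iff_comap_le.2
    (le_iSup₂_of_le (f := fun i (_ : i ∈ I) =>
      MeasurableSpace.comap (Sum.elim x y i) inferInstance) i hi le_rfl)

lemma indep_sampleSigma {P : Measure Ω} (hx : ∀ i, Measurable (x i)) (hy : ∀ i, Measurable (y i))
    (hind : iIndepFun (Sum.elim x y) P) {I J : Set (ℕ ⊕ ℕ)} (hIJ : Disjoint I J) :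
    Indep (sampleSigma x y I) (sampleSigma x y J) P :=
  indep_iSup_of_disjoint (by rintro (i | i); exacts [(hx i).comap_le, (hy i).comap_le]) hind hIJ

omit [NeZero n] in
lemma measurable_sampleBlock (hx : ∀ i, Measurable (x i)) (hy : ∀ i, Measurable (y i)) (t : ℕ) :
    Measurable (sampleBlock n x y t) :=
  (measurable_pi_lambda _ fun _ => hx _).prodMk (measurable_pi_lambda _ fun _ => hy _)

omit [NeZero n] in
lemma map_sampleBlock {P : Measure Ω} [IsProbabilityMeasure P] {α β : ProbabilityMeasure X}
    (hx : ∀ i, Measurable (x i)) (hy : ∀ i, Measurable (y i))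
    (hα : ∀ i, P.map (x i) = α) (hβ : ∀ i, P.map (y i) = β)
    (hind : iIndepFun (Sum.elim x y) P) (t : ℕ) :
    P.map (sampleBlock n x y t) = batchLaw n α β := by
  -- Distinct positions in a block are distinct samples, so independence of the streams restricts to
  -- the block.
  have hinj : Function.Injective fun i : Fin n => t * n + (i : ℕ) := fun i j hij =>
    Fin.ext (Nat.add_left_cancel hij)
  have hmx : Measurable fun ω (i : Fin n) => x (t * n + i) ω := measurable_pi_lambda _ fun _ => hx _
  have hmy : Measurable fun ω (i : Fin n) => y (t * n + i) ω := measurable_pi_lambda _ fun _ => hy _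
  have hlx : P.map (fun ω (i : Fin n) => x (t * n + i) ω) = Measure.pi fun _ => (α : Measure X) := by
    have h1 : iIndepFun (fun i : Fin n => x (t * n + i)) P :=
      hind.precomp (g := fun i : Fin n => Sum.inl (t * n + (i : ℕ))) (Sum.inl_injective.comp hinj)
    rw [(iIndepFun_iff_map_fun_eq_pi_map fun i => (hx _).aemeasurable).1 h1]
    simp only [hα]
  have hly : P.map (fun ω (i : Fin n) => y (t * n + i) ω) = Measure.pi fun _ => (β : Measure X) := by
    have h1 : iIndepFun (fun i : Fin n => y (t * n + i)) P :=
      hind.precomp (g := fun i : Fin n => Sum.inr (t * n + (i : ℕ))) (Sum.inr_injective.comp hinj)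
    rw [(iIndepFun_iff_map_fun_eq_pi_map fun i => (hy _).aemeasurable).1 h1]
    simp only [hβ]
  have hxy : IndepFun (fun ω (i : Fin n) => x (t * n + i) ω)
      (fun ω (i : Fin n) => y (t * n + i) ω) P := by
    rw [IndepFun_iff_Indep]
    refine indep_of_indep_of_le_left (indep_of_indep_of_le_right (indep_sampleSigma hx hy hind
      (I := Set.range Sum.inl) (J := Set.range Sum.inr)
      Set.isCompl_range_inl_range_inr.disjoint) ?_) ?_
    · rw [← measurable_iff_comap_le]
      exact @measurable_pi_lambda _ _ _ (_) _ _ fun i =>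
        measurable_sampleSigma (x := x) (y := y) (i := Sum.inr (t * n + (i : ℕ))) ⟨_, rfl⟩
    · rw [← measurable_iff_comap_le]
      exact @measurable_pi_lambda _ _ _ (_) _ _ fun i =>
        measurable_sampleSigma (x := x) (y := y) (i := Sum.inl (t * n + (i : ℕ))) ⟨_, rfl⟩
  rw [batchLaw, ← hlx, ← hly]
  exact (indepFun_iff_map_prod_eq_prod_map_map hmx.aemeasurable hmy.aemeasurable).1 hxy

omit mΩ in
lemma minibatchSigma_le_sampleSigma (t : ℕ) :
    minibatchSigma n x y t ≤ sampleSigma x y {i | Sum.elim id id i < t * n} := by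
  have hlt : ∀ s < t, ∀ i : Fin n, s * n + (i : ℕ) < t * n := fun s hs i =>
    calc s * n + (i : ℕ) < s * n + n := Nat.add_lt_add_left i.2 _
      _ = (s + 1) * n := by ring
      _ ≤ t * n := Nat.mul_le_mul_right _ hs
  refine iSup₂_le fun s hs => sup_le ?_ ?_
  · rw [← measurable_iff_comap_le]
    refine measurable_empirical.comp (@measurable_pi_lambda _ _ _ (_) _ _ fun i => ?_)
    exact measurable_sampleSigma (i := Sum.inl (s * n + (i : ℕ))) (hlt s hs i)
  · rw [← measurable_iff_comap_le]
    refine measurable_empirical.comp (@measurable_pi_lambda _ _ _ (_) _ _ fun i => ?_)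
    exact measurable_sampleSigma (i := Sum.inr (s * n + (i : ℕ))) (hlt s hs i)

lemma minibatchSigma_le (hx : ∀ i, Measurable (x i)) (hy : ∀ i, Measurable (y i)) (t : ℕ) :
    minibatchSigma n x y t ≤ mΩ :=
  (minibatchSigma_le_sampleSigma t).trans <| iSup₂_le <| by
    rintro (i | i) _
    exacts [(hx i).comap_le, (hy i).comap_le]

omit mΩ in
lemma minibatchSigma_mono : Monotone (minibatchSigma n x y) := fun _ _ hst =>
  iSup₂_le fun s hs => le_iSup₂_of_le (f := fun s (_ : s < _) =>
    MeasurableSpace.comap (fun ω => (minibatch n x s ω : Measure X)) inferInstance ⊔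
    MeasurableSpace.comap (fun ω => (minibatch n y s ω : Measure X)) inferInstance)
    s (hs.trans_le hst) le_rfl

/-- The first `t` minibatches only involve samples with index below `t * n`, in either stream, and
block `t` only those from `t * n` on. -/
lemma indep_minibatchSigma_sampleBlock {P : Measure Ω} (hx : ∀ i, Measurable (x i))
    (hy : ∀ i, Measurable (y i)) (hind : iIndepFun (Sum.elim x y) P) (t : ℕ) :
    Indep (minibatchSigma n x y t)
      (MeasurableSpace.comap (sampleBlock n x y t) inferInstance) P := by
  refine indep_of_indep_of_le_left (indep_of_indep_of_le_right (indep_sampleSigma hx hy hind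
    (I := {i | Sum.elim id id i < t * n}) (J := {i | t * n ≤ Sum.elim id id i}) ?_) ?_)
    (minibatchSigma_le_sampleSigma t)
  · exact Set.disjoint_left.2 fun i hi hi' => not_le.2 (Set.mem_ofPred.1 hi) hi'
  · rw [← measurable_iff_comap_le]
    refine (@measurable_pi_lambda _ _ _ (_) _ _ fun i => ?_).prodMk
      (@measurable_pi_lambda _ _ _ (_) _ _ fun i => ?_)
    · exact measurable_sampleSigma (x := x) (y := y) (i := Sum.inl (t * n + (i : ℕ)))
        (Nat.le_add_right _ _)
    · exact measurable_sampleSigma (x := x) (y := y) (i := Sum.inr (t * n + (i : ℕ)))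
        (Nat.le_add_right _ _)

end Samples

/-! ### The stationary law of the induced kernel -/

section BatchStep

variable {X : Type*} [MetricSpace X] [CompactSpace X] [MeasurableSpace X] [BorelSpace X]
  {n : ℕ} [NeZero n]

/-- One Sinkhorn step from `p` with a pair `s` of batches of samples. -/
noncomputable def batchStep (rule : UpdateRule) (c : C(X × X, ℝ)) (s : (Fin n → X) × (Fin n → X))
    (p : C(X, ℝ) × C(X, ℝ)) : C(X, ℝ) × C(X, ℝ) :=
  step rule c (empirical s.1) (empirical s.2) p

/-- The step on pairs of potentials up to constants with a pair `s` of batches of samples. -/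
noncomputable def batchClassStep (rule : UpdateRule) (c : C(X × X, ℝ)) (s : (Fin n → X) × (Fin n → X))
    (q : PotentialClass X × PotentialClass X) : PotentialClass X × PotentialClass X :=
  classStep rule c (empirical s.1) (empirical s.2) q

lemma measurable_batchStep (rule : UpdateRule) (c : C(X × X, ℝ)) :
    Measurable (Function.uncurry (batchStep (n := n) rule c)) :=
  measurable_step_empirical rule c

lemma continuous_batchClassStep (rule : UpdateRule) (c : C(X × X, ℝ)) :
    Continuous (Function.uncurry (batchClassStep (n := n) rule c)) :=
  continuous_classStep_empirical rule c

lemma measurable_batchClassStep (rule : UpdateRule) (c : C(X × X, ℝ)) :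
    Measurable (Function.uncurry (batchClassStep (n := n) rule c)) :=
  measurable_classStep_empirical rule c

lemma transitionKernel_apply (rule : UpdateRule) (c : C(X × X, ℝ)) (α β : ProbabilityMeasure X)
    (p : C(X, ℝ) × C(X, ℝ)) :
    transitionKernel n rule c α β p = (batchLaw n α β).map (batchStep rule c · p) := rfl

lemma classTransitionKernel_apply (rule : UpdateRule) (c : C(X × X, ℝ))
    (α β : ProbabilityMeasure X) (q : PotentialClass X × PotentialClass X) :
    classTransitionKernel n rule c α β q = (batchLaw n α β).map (batchClassStep rule c · q) := rfl

/-- The induced kernel has a unique stationary probability measure, and its iterates converge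
weakly to it from every initial law. -/
theorem exists_unique_invariant_classTransitionKernel (rule : UpdateRule) (c : C(X × X, ℝ))
    (α β : ProbabilityMeasure X) :
    ∃ (π : Measure (PotentialClass X × PotentialClass X)) (_ : IsProbabilityMeasure π),
      Kernel.Invariant (classTransitionKernel n rule c α β) π ∧
      (∀ π' : Measure (PotentialClass X × PotentialClass X), IsProbabilityMeasure π' →
        Kernel.Invariant (classTransitionKernel n rule c α β) π' → π' = π) ∧
      ∀ m : Measure (PotentialClass X × PotentialClass X), IsProbabilityMeasure m →
        ∀ φ : BoundedContinuousFunction (PotentialClass X × PotentialClass X) ℝ,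
          Tendsto (fun t => ∫ q, φ q ∂((fun μ => μ.bind (classTransitionKernel n rule c α β))^[t] m))
            atTop (𝓝 (∫ q, φ q ∂π)) := by
  obtain ⟨q₀⟩ : Nonempty (PotentialClass X × PotentialClass X) := ⟨toClassPair 0⟩
  have hstep : Continuous fun s : (Fin n → X) × (Fin n → X) => batchClassStep rule c s q₀ :=
    (continuous_batchClassStep rule c).comp (g := Function.uncurry (batchClassStep rule c))
      (f := fun s : (Fin n → X) × (Fin n → X) => (s, q₀)) (Continuous.prodMk_left q₀)
  have hcont : Continuous fun s : (Fin n → X) × (Fin n → X) =>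
      dist q₀ (batchClassStep rule c s q₀) := continuous_const.dist hstep
  -- Batches range over a compact space and the step is continuous in them, so one step moves `q₀`
  -- by a bounded amount.
  obtain ⟨R, hR⟩ := (isCompact_range hcont).bddAbove
  have hK1 : (1 - Real.exp (-(4 * ‖c‖))).toNNReal < 1 := by
    rw [Real.toNNReal_lt_one]
    linarith [Real.exp_pos (-(4 * ‖c‖))]
  exact exists_unique_invariant_of_contracting (F := batchClassStep rule c)
    (measurable_batchClassStep rule c) (classTransitionKernel_apply rule c α β)
    (fun s => lipschitzWith_classStep c.norm_coe_le_norm rule (empirical s.1) (empirical s.2)) hK1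
    fun s => hR ⟨s, rfl⟩

end BatchStep

/-! ### The Sinkhorn iteration as a Markov chain -/

section SinkhornChain

variable {X Ω : Type*} [MetricSpace X] [CompactSpace X] [MeasurableSpace X] [BorelSpace X]
  [mΩ : MeasurableSpace Ω] {n : ℕ} [NeZero n] {x y : ℕ → Ω → X}

omit mΩ in
lemma measurable_chain (rule : UpdateRule) (c : C(X × X, ℝ)) (x y : ℕ → Ω → X)
    (p₀ : C(X, ℝ) × C(X, ℝ)) (t : ℕ) :
    Measurable[minibatchSigma n x y t] (chain n rule c x y p₀ t) := by
  induction t with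
  | zero => exact measurable_const
  | succ t ih =>
    have h1 : MeasurableSpace.comap (fun ω => (minibatch n x t ω : Measure X)) inferInstance ⊔
        MeasurableSpace.comap (fun ω => (minibatch n y t ω : Measure X)) inferInstance ≤
        minibatchSigma n x y (t + 1) :=
      le_iSup₂_of_le (f := fun s (_ : s < t + 1) =>
        MeasurableSpace.comap (fun ω => (minibatch n x s ω : Measure X)) inferInstance ⊔
        MeasurableSpace.comap (fun ω => (minibatch n y s ω : Measure X)) inferInstance)
        t t.lt_succ_self le_rfl
    have ha : Measurable[minibatchSigma n x y (t + 1)] fun ω => (minibatch n x t ω : Measure X) :=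
      measurable_iff_comap_le.2 (le_sup_left.trans h1)
    have hb : Measurable[minibatchSigma n x y (t + 1)] fun ω => (minibatch n y t ω : Measure X) :=
      measurable_iff_comap_le.2 (le_sup_right.trans h1)
    exact @measurable_step X _ _ _ _ rule c Ω (minibatchSigma n x y (t + 1)) _ _ _ ha hb
      (ih.mono (minibatchSigma_mono t.le_succ) le_rfl)

omit mΩ in
lemma chain_succ (rule : UpdateRule) (c : C(X × X, ℝ)) (p₀ : C(X, ℝ) × C(X, ℝ)) (t : ℕ) :
    chain n rule c x y p₀ (t + 1) =
      fun ω => batchStep rule c (sampleBlock n x y t ω) (chain n rule c x y p₀ t ω) := rfl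

omit mΩ in
lemma toClassPair_chain_succ (rule : UpdateRule) (c : C(X × X, ℝ)) (p₀ : C(X, ℝ) × C(X, ℝ))
    (t : ℕ) :
    (fun ω => toClassPair (chain n rule c x y p₀ (t + 1) ω)) = fun ω =>
      batchClassStep rule c (sampleBlock n x y t ω) (toClassPair (chain n rule c x y p₀ t ω)) :=
  funext fun _ => (classStep_toClassPair rule c _ _ _).symm

lemma measurable_toClassPair_chain (rule : UpdateRule) (c : C(X × X, ℝ)) (x y : ℕ → Ω → X)
    (p₀ : C(X, ℝ) × C(X, ℝ)) (t : ℕ) :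
    Measurable[minibatchSigma n x y t] fun ω => toClassPair (chain n rule c x y p₀ t ω) :=
  isOpenQuotientMap_toClassPair.continuous.measurable.comp (measurable_chain rule c x y p₀ t)

variable {P : Measure Ω} [IsProbabilityMeasure P] {α β : ProbabilityMeasure X}

lemma isTimeHomogeneousMarkovChain_chain (rule : UpdateRule) (c : C(X × X, ℝ))
    (hx : ∀ i, Measurable (x i)) (hy : ∀ i, Measurable (y i))
    (hα : ∀ i, P.map (x i) = α) (hβ : ∀ i, P.map (y i) = β)
    (hind : iIndepFun (Sum.elim x y) P) (p₀ : C(X, ℝ) × C(X, ℝ)) :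
    IsTimeHomogeneousMarkovChain (transitionKernel n rule c α β) (minibatchSigma n x y) P
      (chain n rule c x y p₀) where
  isMarkovKernel := inferInstance
  mono := minibatchSigma_mono
  le := minibatchSigma_le hx hy
  adapted := measurable_chain rule c x y p₀
  markov t A hA := by
    rw [chain_succ]
    exact condExp_randomMap (F := batchStep rule c) (s := sampleBlock n x y t)
      (Z := chain n rule c x y p₀ t) (κ := transitionKernel n rule c α β) (ν := batchLaw n α β)
      (measurable_batchStep rule c) (transitionKernel_apply rule c α β)
      (minibatchSigma_le hx hy t) (measurable_sampleBlock hx hy t)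
      (measurable_chain rule c x y p₀ t) (map_sampleBlock hx hy hα hβ hind t)
      (indep_minibatchSigma_sampleBlock hx hy hind t) hA

lemma isTimeHomogeneousMarkovChain_toClassPair_chain (rule : UpdateRule) (c : C(X × X, ℝ))
    (hx : ∀ i, Measurable (x i)) (hy : ∀ i, Measurable (y i))
    (hα : ∀ i, P.map (x i) = α) (hβ : ∀ i, P.map (y i) = β)
    (hind : iIndepFun (Sum.elim x y) P) (p₀ : C(X, ℝ) × C(X, ℝ)) :
    IsTimeHomogeneousMarkovChain (classTransitionKernel n rule c α β) (minibatchSigma n x y) P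
      (fun t ω => toClassPair (chain n rule c x y p₀ t ω)) where
  isMarkovKernel := inferInstance
  mono := minibatchSigma_mono
  le := minibatchSigma_le hx hy
  adapted := measurable_toClassPair_chain rule c x y p₀
  markov t A hA := by
    rw [toClassPair_chain_succ]
    exact condExp_randomMap (F := batchClassStep rule c) (s := sampleBlock n x y t)
      (Z := fun ω => toClassPair (chain n rule c x y p₀ t ω))
      (κ := classTransitionKernel n rule c α β) (ν := batchLaw n α β)
      (measurable_batchClassStep rule c) (classTransitionKernel_apply rule c α β)
      (minibatchSigma_le hx hy t) (measurable_sampleBlock hx hy t)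
      (measurable_toClassPair_chain rule c x y p₀ t) (map_sampleBlock hx hy hα hβ hind t)
      (indep_minibatchSigma_sampleBlock hx hy hind t) hA

/-- Each fresh block is independent of the current state, so one step applies the kernel to its law.
This identifies the law at time `t` with the iterates whose limit is known. -/
lemma map_toClassPair_chain (rule : UpdateRule) (c : C(X × X, ℝ))
    (hx : ∀ i, Measurable (x i)) (hy : ∀ i, Measurable (y i))
    (hα : ∀ i, P.map (x i) = α) (hβ : ∀ i, P.map (y i) = β)
    (hind : iIndepFun (Sum.elim x y) P) (p₀ : C(X, ℝ) × C(X, ℝ)) (t : ℕ) :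
    P.map (fun ω => toClassPair (chain n rule c x y p₀ t ω)) =
      (fun μ => μ.bind (classTransitionKernel n rule c α β))^[t]
        (Measure.dirac (toClassPair p₀)) := by
  induction t with
  | zero => simp [chain]
  | succ t ih =>
    have hZ := measurable_toClassPair_chain (n := n) rule c x y p₀ t
    have hsZ : IndepFun (sampleBlock n x y t)
        (fun ω => toClassPair (chain n rule c x y p₀ t ω)) P := by
      rw [IndepFun_iff_Indep]
      exact indep_of_indep_of_le_right (indep_minibatchSigma_sampleBlock hx hy hind t).symm
        hZ.comap_le
    rw [Function.iterate_succ_apply', ← ih, toClassPair_chain_succ]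
    exact map_randomMap_eq_bind (F := batchClassStep rule c) (s := sampleBlock n x y t)
      (Z := fun ω => toClassPair (chain n rule c x y p₀ t ω))
      (κ := classTransitionKernel n rule c α β) (ν := batchLaw n α β)
      (measurable_batchClassStep rule c) (classTransitionKernel_apply rule c α β)
      (measurable_sampleBlock hx hy t) (hZ.mono (minibatchSigma_le hx hy t) le_rfl)
      (map_sampleBlock hx hy hα hβ hind t) hsZ

end SinkhornChain

end RandomizedSinkhorn

theorem mainTheorem4 {X : Type*} [MetricSpace X] [CompactSpace X] [MeasurableSpace X]
    [BorelSpace X] (c : C(X × X, ℝ)) (L : ℝ≥0) (hc : LipschitzWith L c)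
    (α β : ProbabilityMeasure X) (n : ℕ) [NeZero n] (rule : RandomizedSinkhorn.UpdateRule) :
    ∃ (π : Measure (RandomizedSinkhorn.PotentialClass X × RandomizedSinkhorn.PotentialClass X))
      (_ : IsProbabilityMeasure π),
      Kernel.Invariant (RandomizedSinkhorn.classTransitionKernel n rule c α β) π ∧
      (∀ π' : Measure (RandomizedSinkhorn.PotentialClass X × RandomizedSinkhorn.PotentialClass X),
        IsProbabilityMeasure π' →
        Kernel.Invariant (RandomizedSinkhorn.classTransitionKernel n rule c α β) π' → π' = π) ∧
      ∀ {Ω : Type*} [MeasurableSpace Ω] (P : Measure Ω) [IsProbabilityMeasure P]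
        (x y : ℕ → Ω → X), (∀ i, Measurable (x i)) → (∀ i, Measurable (y i)) →
        (∀ i, P.map (x i) = α) → (∀ i, P.map (y i) = β) → iIndepFun (Sum.elim x y) P →
        ∀ p₀ : C(X, ℝ) × C(X, ℝ),
          RandomizedSinkhorn.IsTimeHomogeneousMarkovChain
            (RandomizedSinkhorn.transitionKernel n rule c α β)
            (RandomizedSinkhorn.minibatchSigma n x y) P
            (RandomizedSinkhorn.chain n rule c x y p₀) ∧
          RandomizedSinkhorn.IsTimeHomogeneousMarkovChain
            (RandomizedSinkhorn.classTransitionKernel n rule c α β)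
            (RandomizedSinkhorn.minibatchSigma n x y) P
            (fun t ω => RandomizedSinkhorn.toClassPair
              (RandomizedSinkhorn.chain n rule c x y p₀ t ω)) ∧
          TendstoInDistribution
            (fun t ω => RandomizedSinkhorn.toClassPair
              (RandomizedSinkhorn.chain n rule c x y p₀ t ω))
            atTop id (fun _ => P) π := by
  obtain ⟨π, hπ, hinv, huniq, hconv⟩ :=
    RandomizedSinkhorn.exists_unique_invariant_classTransitionKernel (n := n) rule c α β
  refine ⟨π, hπ, hinv, huniq, fun P _ x y hx hy hα hβ hind p₀ =>
    ⟨RandomizedSinkhorn.isTimeHomogeneousMarkovChain_chain rule c hx hy hα hβ hind p₀,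
      RandomizedSinkhorn.isTimeHomogeneousMarkovChain_toClassPair_chain rule c hx hy hα hβ hind p₀,
      fun t => ((RandomizedSinkhorn.measurable_toClassPair_chain rule c x y p₀ t).mono
        (RandomizedSinkhorn.minibatchSigma_le hx hy t) le_rfl).aemeasurable, aemeasurable_id, ?_⟩⟩
  -- Weak convergence is tested on bounded continuous functions, for the kernel iterates started
  -- from the Dirac mass at the initial classes.
  refine ProbabilityMeasure.tendsto_iff_forall_integral_tendsto.2 fun φ => ?_
  simp only [ProbabilityMeasure.coe_mk, Measure.map_id,
    RandomizedSinkhorn.map_toClassPair_chain rule c hx hy hα hβ hind p₀]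
  exact hconv _ Measure.dirac.isProbabilityMeasure φ
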